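/- Let $2\le r_1<r_2$ and $n$ be integers such that $h_0:=n-5-2(r_1+r_2)\ge 2$. For $h,q_1,q_2\ge 2$ let $[h,q_1,q_2]$ denote the following tree: a vertex $u$ is joined to an end vertex of each of three disjoint paths, with $h$, $q_1$ and $q_2$ vertices; to the other end vertex of the path with $q_1$ vertices one attaches $r_1$ pendant paths with two vertices each, and to the other end vertex of the path with $q_2$ vertices one attaches $r_2$ pendant paths with two vertices each. It has $1+h+q_1+q_2+2(r_1+r_2)$ vertices. Let $$\mathfrak F(n)=\{[h,q_1,q_2] : h,q_1,q_2\ge 2,\ h+q_1+q_2=n-1-2(r_1+r_2)\},$$ let $\rho(T)$ be the spectral radius (index) of $T$, that is, the largest eigenvalue of its adjacency matrix, and for $h\ge 3$ put $\alpha([h,q_1,q_2])=[h-1,q_1+1,q_2]$ and $\gamma([h,q_1,q_2])=[h-1,q_1,q_2+1]$. Let $T^*=[h_0,2,2]$ and $T_*=[2,2,h_0]$, and write $[x,y,z]\succ[x',y',z']$ if $z'>z$, or $z'=z$ and $y'>y$. Then $T^*,T_*\in\mathfrak F(n)$ and the following hold. (a) The terms of the sequence $$\mathcal A:\quad T^*,\alpha(T^*),\dots,\alpha^{h_0-2}(T^*),\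 \gamma(T^*),\alpha(\gamma(T^*)),\dots,\alpha^{h_0-3}(\gamma(T^*)),\ \dots,\ \gamma^{h_0-2}(T^*)$$ (for $j=0,1,\dots,h_0-2$ in turn, the run $\alpha^k(\gamma^j(T^*))$, $k=0,\dots,h_0-2-j$) are exactly the members of $\mathfrak F(n)$, and its last term is $\gamma^{h_0-2}(T^*)=T_*$. (b) The sequence $\mathcal A$ is arranged in the order $\succ$: each term is $\succ$ every later term. (c) If $T,T'\in\mathfrak F(n)$ and $T\succ T'$, then $\rho(T)>\rho(T')$. In particular distinct members of $\mathfrak F(n)$ have distinct indices, so the ordering of $\mathfrak F(n)$ by the index is total. (d) The maximum of $\rho$ on $\mathfrak F(n)$ is $\rho(T^*)$ and its minimum is $\rho(T_*)$. -/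

import Mathlib

namespace SwitchTree

/-- The largest eigenvalue of the adjacency matrix of a finite graph: its spectral radius, or index.
For a nonempty finite graph the supremum is attained, see `index_isGreatest`. -/
noncomputable def index {V : Type*} [Fintype V] [DecidableEq V] (G : SimpleGraph V)
    [DecidableRel G.Adj] : ℝ :=
  sSup {μ : ℝ | Module.End.HasEigenvalue (Matrix.toLin' (G.adjMatrix ℝ)) μ}

theorem index_isGreatest {V : Type*} [Fintype V] [DecidableEq V] [Nonempty V]
    (G : SimpleGraph V) [DecidableRel G.Adj] :
    IsGreatest {μ : ℝ | Module.End.HasEigenvalue (Matrix.toLin' (G.adjMatrix ℝ)) μ} (index G) := by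
  have hfin : {μ : ℝ | Module.End.HasEigenvalue (Matrix.toLin' (G.adjMatrix ℝ)) μ}.Finite :=
    Module.End.finite_hasEigenvalue _
  have hherm : (G.adjMatrix ℝ).IsHermitian := by
    rw [Matrix.IsHermitian, Matrix.conjTranspose_eq_transpose_of_trivial]
    exact G.transpose_adjMatrix
  have hne : {μ : ℝ | Module.End.HasEigenvalue (Matrix.toLin' (G.adjMatrix ℝ)) μ}.Nonempty := by
    obtain ⟨v⟩ := ‹Nonempty V›
    refine ⟨hherm.eigenvalues v, ?_⟩
    have hs := hherm.eigenvalues_mem_spectrum_real v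
    rw [← Matrix.spectrum_toLin'] at hs
    exact Module.End.hasEigenvalue_iff_mem_spectrum.mpr hs
  exact ⟨hne.csSup_mem hfin, fun μ hμ => le_csSup hfin.bddAbove hμ⟩

/-- The label `[h, q₁, q₂]` of a tree; the numbers `r₁, r₂` are fixed parameters. -/
@[ext]
structure Label where
  h : ℕ
  q₁ : ℕ
  q₂ : ℕ

/-- Vertices of the tree `[h, q₁, q₂]`: the root `u`; the `h` vertices of the pendant path at `u`;
the `q₁` (resp. `q₂`) vertices of the path from `u` to the centre of the sun with `r₁`
(resp. `r₂`) rays, that centre being the last of them; and the two vertices of each ray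
(`0` is the one next to the centre, `1` is the leaf). -/
inductive Vertex (r₁ r₂ : ℕ) (T : Label) : Type
  | root : Vertex r₁ r₂ T
  | stem : Fin T.h → Vertex r₁ r₂ T
  | arm₁ : Fin T.q₁ → Vertex r₁ r₂ T
  | arm₂ : Fin T.q₂ → Vertex r₁ r₂ T
  | ray₁ : Fin r₁ → Fin 2 → Vertex r₁ r₂ T
  | ray₂ : Fin r₂ → Fin 2 → Vertex r₁ r₂ T
deriving DecidableEq, Fintype

/-- The edges, directed away from the root. Path vertices are numbered `0, 1, …` starting at the
neighbour of the root. -/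
def Edge {r₁ r₂ : ℕ} {T : Label} : Vertex r₁ r₂ T → Vertex r₁ r₂ T → Prop
  | .root, .stem i => i.val = 0
  | .root, .arm₁ i => i.val = 0
  | .root, .arm₂ i => i.val = 0
  | .stem i, .stem j => i.val + 1 = j.val
  | .arm₁ i, .arm₁ j => i.val + 1 = j.val
  | .arm₂ i, .arm₂ j => i.val + 1 = j.val
  | .arm₁ i, .ray₁ _ s => i.val + 1 = T.q₁ ∧ s = 0
  | .arm₂ i, .ray₂ _ s => i.val + 1 = T.q₂ ∧ s = 0
  | .ray₁ k s, .ray₁ l t => k = l ∧ s = 0 ∧ t = 1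
  | .ray₂ k s, .ray₂ l t => k = l ∧ s = 0 ∧ t = 1
  | _, _ => False

/-- The tree `[h, q₁, q₂] = u + P_h ∗ S_0 ⊕ P_{q₁} ∗ S_{r₁} ⊕ P_{q₂} ∗ S_{r₂}`. -/
def tree (r₁ r₂ : ℕ) (T : Label) : SimpleGraph (Vertex r₁ r₂ T) :=
  SimpleGraph.fromRel Edge

open Classical in
/-- The spectral radius of the tree `[h, q₁, q₂]`. -/
noncomputable def rho (r₁ r₂ : ℕ) (T : Label) : ℝ :=
  index (tree r₁ r₂ T)

/-- The (labels of the) trees `[h, q₁, q₂]` on `n` vertices with `h, q₁, q₂ ≥ 2`. -/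
def family (n r₁ r₂ : ℕ) : Set Label :=
  {T | 2 ≤ T.h ∧ 2 ≤ T.q₁ ∧ 2 ≤ T.q₂ ∧ 1 + T.h + T.q₁ + T.q₂ + 2 * (r₁ + r₂) = n}

/-- `α [h, q₁, q₂] = [h - 1, q₁ + 1, q₂]`, meant for `h ≥ 3`. -/
def alpha (T : Label) : Label := ⟨T.h - 1, T.q₁ + 1, T.q₂⟩

/-- `γ [h, q₁, q₂] = [h - 1, q₁, q₂ + 1]`, meant for `h ≥ 3`. -/
def gamma (T : Label) : Label := ⟨T.h - 1, T.q₁, T.q₂ + 1⟩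

theorem alpha_mem {n r₁ r₂ : ℕ} {T : Label} (hT : T ∈ family n r₁ r₂) (h : 3 ≤ T.h) :
    alpha T ∈ family n r₁ r₂ := by
  simp only [family, alpha, Set.mem_ofPred_eq] at *
  omega

theorem gamma_mem {n r₁ r₂ : ℕ} {T : Label} (hT : T ∈ family n r₁ r₂) (h : 3 ≤ T.h) :
    gamma T ∈ family n r₁ r₂ := by
  simp only [family, gamma, Set.mem_ofPred_eq] at *
  omega

/-- `T^* = [h₀, 2, 2]`. -/
def topLabel (h₀ : ℕ) : Label := ⟨h₀, 2, 2⟩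

/-- `T_* = [2, 2, h₀]`. -/
def botLabel (h₀ : ℕ) : Label := ⟨2, 2, h₀⟩

/-- The ordered sequence
`T^*, α T^*, …, α^(h₀-2) T^*, γ T^*, α (γ T^*), …, α^(h₀-3) (γ T^*), …, γ^(h₀-2) T^*`:
for `j = 0, …, h₀ - 2` in turn, the run `α^k (γ^j T^*)`, `k = 0, …, h₀ - 2 - j`. -/
def chain (h₀ : ℕ) : List Label :=
  (List.range (h₀ - 1)).flatMap fun j =>
    (List.range (h₀ - 1 - j)).map fun k => alpha^[k] (gamma^[j] (topLabel h₀))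

/-- Inverse lexicographic order: `T ≻ T'`. -/
def Succeeds (T T' : Label) : Prop :=
  T.q₂ < T'.q₂ ∨ (T'.q₂ = T.q₂ ∧ T.q₁ < T'.q₁)

end SwitchTree

namespace SwitchTree

/-! An eigenvalue with a positive eigenvector is the index, so it suffices to exhibit one. Writing
it as `p + p⁻¹` with `0 < p < 1` and `τ = p²`, the equations away from the root are solved in closed
form along the stem and both arms, and the equation at the root becomes `rootFun T τ = 0`. On `[0,
σ]`, with `σ` the zero of `centreCoeff r₂`, `rootFun` goes from 1 to a negative value. If `rootFun
T'` is positive at a zero `τ` of `rootFun T`, then `T'` has a zero beyond `τ`, hence a smaller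
index, since `p + p⁻¹` decreases on `(0, 1)`.

Shortening the stem and lengthening arms raises `rootFun` termwise (`rho_lt_of_le`); this settles
each run and reduces runs with larger `q₂` to one comparison: the last label `[2, k+1, z]` of a run
against the first label `[k, 2, z+1]` of the next (`rho_lt_of_wrap`). Only there is `r₁ < r₂` needed
strictly. -/

/-! ### Positive eigenvectors -/

/-- For any eigenvector `z` with eigenvalue `μ`, the triangle inequality gives `μ|z| ≤ A|z|`;
pairing with `x` and using the symmetry of `A` yields `μ⟨x, |z|⟩ ≤ c⟨x, |z|⟩`. Connectedness plays
no role. -/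
theorem index_eq_of_pos {V : Type*} [Fintype V] [DecidableEq V] [Nonempty V]
    (G : SimpleGraph V) [DecidableRel G.Adj] {x : V → ℝ} {c : ℝ} (hx : ∀ v, 0 < x v)
    (h : ∀ v, ∑ w, (if G.Adj v w then x w else 0) = c * x v) : index G = c := by
  refine (index_isGreatest G).unique ⟨?_, ?_⟩
  · refine Module.End.hasEigenvalue_of_hasEigenvector (x := x) ?_
    rw [Module.End.hasEigenvector_iff, Module.End.mem_eigenspace_iff]
    refine ⟨?_, ?_⟩
    · ext v
      rw [Matrix.toLin'_apply]
      simp only [Matrix.mulVec, dotProduct, SimpleGraph.adjMatrix_apply, ite_mul, one_mul,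
        zero_mul, Pi.smul_apply, smul_eq_mul]
      exact h v
    · obtain ⟨v⟩ := ‹Nonempty V›
      intro h0
      have := hx v
      simp [h0] at this
  · rintro μ hμ
    obtain ⟨z, hz⟩ := Module.End.HasEigenvalue.exists_hasEigenvector hμ
    rw [Module.End.hasEigenvector_iff, Module.End.mem_eigenspace_iff] at hz
    obtain ⟨hz, hz0⟩ := hz
    have hz' : ∀ v, ∑ w, (if G.Adj v w then z w else 0) = μ * z v := by
      intro v
      have := congrFun hz v
      rw [Matrix.toLin'_apply] at this
      simpa only [Matrix.mulVec, dotProduct, SimpleGraph.adjMatrix_apply, ite_mul, one_mul,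
        zero_mul, Pi.smul_apply, smul_eq_mul] using this
    have hle : ∀ v, μ * |z v| ≤ ∑ w, (if G.Adj v w then |z w| else 0) := by
      intro v
      calc μ * |z v| ≤ |μ| * |z v| := by gcongr; exact le_abs_self μ
        _ = |∑ w, (if G.Adj v w then z w else 0)| := by rw [hz', abs_mul]
        _ ≤ ∑ w, |if G.Adj v w then z w else 0| := Finset.abs_sum_le_sum_abs _ _
        _ = _ := Finset.sum_congr rfl fun w _ => by split_ifs <;> simp
    have hpos : 0 < ∑ v, x v * |z v| := by
      obtain ⟨v, hv⟩ : ∃ v, z v ≠ 0 := by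
        by_contra! hc
        exact hz0 (funext hc)
      refine Finset.sum_pos' (fun w _ => mul_nonneg (hx w).le (abs_nonneg _))
        ⟨v, Finset.mem_univ v, mul_pos (hx v) (abs_pos.2 hv)⟩
    have key : μ * ∑ v, x v * |z v| ≤ c * ∑ v, x v * |z v| := by
      calc μ * ∑ v, x v * |z v| = ∑ v, x v * (μ * |z v|) := by
            rw [Finset.mul_sum]; exact Finset.sum_congr rfl fun v _ => by ring
        _ ≤ ∑ v, x v * ∑ w, (if G.Adj v w then |z w| else 0) :=
            Finset.sum_le_sum fun v _ => mul_le_mul_of_nonneg_left (hle v) (hx v).le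
        _ = ∑ v, ∑ w, (if G.Adj v w then x v * |z w| else 0) := by
            refine Finset.sum_congr rfl fun v _ => ?_
            rw [Finset.mul_sum]
            exact Finset.sum_congr rfl fun w _ => by split_ifs <;> simp
        _ = ∑ w, ∑ v, (if G.Adj v w then x v * |z w| else 0) := Finset.sum_comm
        _ = ∑ w, c * x w * |z w| := by
            refine Finset.sum_congr rfl fun w _ => ?_
            rw [← h w, Finset.sum_mul]
            exact Finset.sum_congr rfl fun v _ => by simp only [G.adj_comm w v]; split_ifs <;> simp
        _ = c * ∑ v, x v * |z v| := by
            rw [Finset.mul_sum]; exact Finset.sum_congr rfl fun v _ => by ring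
    exact le_of_mul_le_mul_right key hpos

/-! ### Eigenvalue equations on the tree -/

/-- The vertices of the tree, sorted by kind. -/
def vertexEquiv (r₁ r₂ : ℕ) (T : Label) :
    Vertex r₁ r₂ T ≃ Unit ⊕ Fin T.h ⊕ Fin T.q₁ ⊕ Fin T.q₂ ⊕ (Fin r₁ × Fin 2) ⊕ (Fin r₂ × Fin 2) where
  toFun
    | .root => .inl ()
    | .stem i => .inr (.inl i)
    | .arm₁ i => .inr (.inr (.inl i))
    | .arm₂ i => .inr (.inr (.inr (.inl i)))
    | .ray₁ k s => .inr (.inr (.inr (.inr (.inl (k, s)))))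
    | .ray₂ k s => .inr (.inr (.inr (.inr (.inr (k, s)))))
  invFun
    | .inl _ => .root
    | .inr (.inl i) => .stem i
    | .inr (.inr (.inl i)) => .arm₁ i
    | .inr (.inr (.inr (.inl i))) => .arm₂ i
    | .inr (.inr (.inr (.inr (.inl (k, s))))) => .ray₁ k s
    | .inr (.inr (.inr (.inr (.inr (k, s))))) => .ray₂ k s
  left_inv v := by cases v <;> rfl
  right_inv v := by rcases v with _ | _ | _ | _ | _ | _ <;> rfl

theorem sum_vertex {r₁ r₂ : ℕ} {T : Label} (f : Vertex r₁ r₂ T → ℝ) :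
    ∑ v, f v = f .root + (∑ i, f (.stem i)) + (∑ i, f (.arm₁ i)) + (∑ i, f (.arm₂ i)) +
      (∑ k, (f (.ray₁ k 0) + f (.ray₁ k 1))) + ∑ k, (f (.ray₂ k 0) + f (.ray₂ k 1)) := by
  rw [← (vertexEquiv r₁ r₂ T).symm.sum_comp]
  simp only [Fintype.sum_sum_type, Fintype.sum_prod_type, Fin.sum_univ_two, vertexEquiv,
    Equiv.coe_fn_symm_mk, Finset.univ_unique, Finset.sum_singleton]
  ring

open Classical in
/-- `y` if `P` holds, and `0` otherwise. -/
noncomputable def select (P : Prop) (y : ℝ) : ℝ := if P then y else 0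

theorem select_pos {P : Prop} (h : P) (y : ℝ) : select P y = y := if_pos h

theorem select_neg {P : Prop} (h : ¬P) (y : ℝ) : select P y = 0 := if_neg h

theorem sum_fin_eq {m k : ℕ} (hk : k < m) (f : ℕ → ℝ) :
    ∑ j : Fin m, select (k = j.val) (f j.val) = f k := by
  rw [Finset.sum_eq_single (⟨k, hk⟩ : Fin m)]
  · simp [select_pos]
  · intro j _ hj
    refine select_neg ?_ _
    rintro rfl
    exact hj rfl
  · simp

/-- `Edge` is never symmetric on a pair, so children and parent contribute separately without double
counting. -/
theorem sum_adj {r₁ r₂ : ℕ} {T : Label} [DecidableRel (tree r₁ r₂ T).Adj]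
    (x : Vertex r₁ r₂ T → ℝ) (v : Vertex r₁ r₂ T) :
    ∑ w, (if (tree r₁ r₂ T).Adj v w then x w else 0) =
      (∑ w, select (Edge v w) (x w)) + ∑ w, select (Edge w v) (x w) := by
  rw [← Finset.sum_add_distrib]
  refine Finset.sum_congr rfl fun w _ => ?_
  have h1 : ¬ (Edge v w ∧ Edge w v) := by
    cases v <;> cases w <;> simp only [Edge] <;> grind
  have h2 : Edge v w → v ≠ w := by
    rintro h rfl
    exact h1 ⟨h, h⟩
  have h3 : Edge w v → v ≠ w := by
    rintro h rfl
    exact h1 ⟨h, h⟩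
  by_cases ha : Edge v w <;> by_cases hb : Edge w v <;>
    simp_all [tree, SimpleGraph.fromRel_adj, select_pos, select_neg]

/-- The vector with value `S i` (resp. `Y i`, `Z i`) at distance `i` from the root along the stem
(resp. the two arms), and with values `m`, `l` (resp. `m'`, `l'`) along the rays. -/
def treeVector {r₁ r₂ : ℕ} {T : Label} (S Y Z : ℕ → ℝ) (m l m' l' : ℝ) : Vertex r₁ r₂ T → ℝ
  | .root => S 0
  | .stem i => S (i.val + 1)
  | .arm₁ i => Y (i.val + 1)
  | .arm₂ i => Z (i.val + 1)
  | .ray₁ _ s => if s = 0 then m else l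
  | .ray₂ _ s => if s = 0 then m' else l'

/-- The parent of a path vertex is the root or the preceding path vertex; indexing by distance from
the root treats both alike. -/
theorem sum_fin_prev {m : ℕ} (k : Fin m) (f : ℕ → ℝ) :
    select (k.val = 0) (f 0) + ∑ j : Fin m, select (j.val + 1 = k.val) (f (j.val + 1)) =
      f k := by
  obtain ⟨k, hk⟩ := k
  cases k with
  | zero => simp [select_pos, select_neg]
  | succ k =>
    have := sum_fin_eq (show k < m by omega) (fun i => f (i + 1))
    simp only [Nat.add_right_cancel_iff, Nat.succ_ne_zero, not_false_eq_true, select_neg, zero_add]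
    rw [← this]
    exact Finset.sum_congr rfl fun j _ => by simp only [eq_comm]

theorem sum_fin_last {q : ℕ} (hq : 1 ≤ q) (f : ℕ → ℝ) :
    ∑ j : Fin q, select (j.val + 1 = q) (f (j.val + 1)) = f q := by
  obtain ⟨k, rfl⟩ : ∃ k, q = k + 1 := ⟨q - 1, by omega⟩
  rw [← sum_fin_eq (Nat.lt_succ_self k) (fun i => f (i + 1))]
  exact Finset.sum_congr rfl fun j _ => by simp only [Nat.add_right_cancel_iff, eq_comm]

theorem sum_fin_head {q : ℕ} (hq : 1 ≤ q) (f : ℕ → ℝ) :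
    ∑ j : Fin q, select (j.val = 0) (f (j.val + 1)) = f 1 := by
  rw [← sum_fin_eq (show 0 < q by omega) (fun i => f (i + 1))]
  exact Finset.sum_congr rfl fun j _ => by simp only [eq_comm]

theorem sum_fin_next (q k : ℕ) (f : ℕ → ℝ) :
    ∑ j : Fin q, select (k + 1 = j.val) (f (j.val + 1)) = if k + 1 < q then f (k + 2) else 0 := by
  split_ifs with h
  · exact sum_fin_eq h (fun i => f (i + 1))
  · exact Finset.sum_eq_zero fun j _ => select_neg (by have := j.2; omega) _

theorem treeVector_eigen {r₁ r₂ : ℕ} {T : Label} [DecidableRel (tree r₁ r₂ T).Adj]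
    (hh : 1 ≤ T.h) (hq₁ : 1 ≤ T.q₁) (hq₂ : 1 ≤ T.q₂)
    {S Y Z : ℕ → ℝ} {m l m' l' c : ℝ} (hSY : S 0 = Y 0) (hSZ : S 0 = Z 0)
    (hroot : S 1 + Y 1 + Z 1 = c * S 0)
    (hS : ∀ i < T.h, S i + (if i + 1 < T.h then S (i + 2) else 0) = c * S (i + 1))
    (hY : ∀ i, i + 1 < T.q₁ → Y i + Y (i + 2) = c * Y (i + 1))
    (hYq : Y (T.q₁ - 1) + r₁ * m = c * Y T.q₁)
    (hZ : ∀ i, i + 1 < T.q₂ → Z i + Z (i + 2) = c * Z (i + 1))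
    (hZq : Z (T.q₂ - 1) + r₂ * m' = c * Z T.q₂)
    (hm : Y T.q₁ + l = c * m) (hl : m = c * l) (hm' : Z T.q₂ + l' = c * m') (hl' : m' = c * l')
    (v : Vertex r₁ r₂ T) :
    ∑ w, (if (tree r₁ r₂ T).Adj v w then treeVector S Y Z m l m' l' w else 0) =
      c * treeVector S Y Z m l m' l' v := by
  have hst : ∀ y, select True y = y := select_pos trivial
  have hsf : ∀ y, select False y = 0 := select_neg not_false
  rw [sum_adj, sum_vertex, sum_vertex]
  cases v with
  | root =>
    simp [Edge, treeVector, sum_fin_head, hh, hq₁, hq₂, hroot, hsf]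
  | stem i =>
    have h1 := hS i i.2
    have h2 := sum_fin_prev i S
    simp only [Edge, treeVector, sum_fin_next, hsf, Finset.sum_const_zero, add_zero]
    linarith
  | arm₁ i =>
    have h3 := sum_fin_prev i Y
    simp only [Edge, treeVector, sum_fin_next, hsf, Finset.sum_const_zero, hSY]
    by_cases h1 : i.val + 1 < T.q₁
    · have := hY i h1
      have h2 : i.val + 1 ≠ T.q₁ := by omega
      simp [h1, h2, hsf]
      linarith
    · have h2 : i.val + 1 = T.q₁ := by omega
      rw [show T.q₁ - 1 = i.val by omega, congrArg Y h2.symm] at hYq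
      simp [h2, hst, hsf]
      rw [congrArg Y h2.symm]
      linarith
  | arm₂ i =>
    have h3 := sum_fin_prev i Z
    simp only [Edge, treeVector, sum_fin_next, hsf, Finset.sum_const_zero, hSZ]
    by_cases h1 : i.val + 1 < T.q₂
    · have := hZ i h1
      have h2 : i.val + 1 ≠ T.q₂ := by omega
      simp [h1, h2, hsf]
      linarith
    · have h2 : i.val + 1 = T.q₂ := by omega
      rw [show T.q₂ - 1 = i.val by omega, congrArg Z h2.symm] at hZq
      simp [h2, hst, hsf]
      rw [congrArg Z h2.symm]
      linarith
  | ray₁ k s =>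
    have h (y : ℝ) : ∑ j, select (j = k) y = y := by
      rw [Finset.sum_eq_single k] <;> simp +contextual [hst, hsf]
    fin_cases s
    · simp [Edge, treeVector, sum_fin_last, hq₁, hsf, eq_comm (a := k), h]
      linarith
    · simp [Edge, treeVector, hsf, hl, h]
  | ray₂ k s =>
    have h (y : ℝ) : ∑ j, select (j = k) y = y := by
      rw [Finset.sum_eq_single k] <;> simp +contextual [hst, hsf]
    fin_cases s
    · simp [Edge, treeVector, sum_fin_last, hq₂, hsf, eq_comm (a := k), h]
      linarith
    · simp [Edge, treeVector, hsf, hl', h]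

/-! ### Explicit solutions along stem and arms -/

/-- The coefficient `a` of the solution along an arm: with `c = p + p⁻¹` and `τ = p²`, the values
`(a + b τ ^ k) / p ^ k`, `k = 0, 1, …`, solve the eigenvalue equation
`y (k - 1) + y (k + 1) = c y k` along the path starting at the centre of a sun with `r` rays. -/
def centreCoeff (r : ℕ) (τ : ℝ) : ℝ := 1 - (r - 1) * (τ + τ ^ 2)

/-- The coefficient `b` belonging to `centreCoeff`. -/
def decayCoeff (r : ℕ) (τ : ℝ) : ℝ := (r - 1) * (τ + τ ^ 2) - τ ^ 3

/-- The contribution of an arm with `q` vertices ending in a sun with `r` rays to the eigenvalue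
equation at the root. -/
noncomputable def armTerm (r q : ℕ) (τ : ℝ) : ℝ :=
  centreCoeff r τ / (centreCoeff r τ + decayCoeff r τ * τ ^ q)

/-- The eigenvalue equation at the root of the tree is `rootFun T τ = 0`. -/
noncomputable def rootFun (r₁ r₂ : ℕ) (T : Label) (τ : ℝ) : ℝ :=
  1 / (1 - τ ^ (T.h + 1)) + armTerm r₁ T.q₁ τ + armTerm r₂ T.q₂ τ - 1 - 1 / (1 - τ)

/-- The solution of the eigenvalue equation along an arm, at distance `k` from the centre. -/
noncomputable def armSol (r : ℕ) (p : ℝ) (k : ℕ) : ℝ :=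
  (centreCoeff r (p ^ 2) + decayCoeff r (p ^ 2) * (p ^ 2) ^ k) / p ^ k

/-- The solution of the eigenvalue equation along the stem, at distance `k` from its missing
neighbour beyond the leaf. -/
noncomputable def stemSol (p : ℝ) (k : ℕ) : ℝ := (1 - (p ^ 2) ^ k) / p ^ k

theorem armSol_rec (r : ℕ) {p : ℝ} (hp : p ≠ 0) (k : ℕ) :
    armSol r p k + armSol r p (k + 2) = (p + p⁻¹) * armSol r p (k + 1) := by
  simp only [armSol]
  generalize centreCoeff r (p ^ 2) = a
  generalize decayCoeff r (p ^ 2) = b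
  simp only [pow_succ _ k, pow_succ _ (k + 1)]
  field_simp
  ring

theorem stemSol_rec {p : ℝ} (hp : p ≠ 0) (k : ℕ) :
    stemSol p k + stemSol p (k + 2) = (p + p⁻¹) * stemSol p (k + 1) := by
  simp only [stemSol]
  simp only [pow_succ _ k, pow_succ _ (k + 1)]
  field_simp
  ring

/-- This equation at the centre fixes `a` and `b`: each ray carries `p ^ 3 * stemSol p k` for `k =
1, 2`, which forces the centre value `a + b = 1 - τ ^ 3` for every `r`. -/
theorem armSol_centre (r : ℕ) {p : ℝ} (hp : p ≠ 0) :
    armSol r p 1 + r * (p * (1 - p ^ 4)) = (p + p⁻¹) * armSol r p 0 := by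
  simp only [armSol, centreCoeff, decayCoeff]
  field_simp
  ring

theorem decayCoeff_pos {r : ℕ} (hr : 2 ≤ r) {τ : ℝ} (h0 : 0 < τ) (h1 : τ < 1) :
    0 < decayCoeff r τ := by
  have : (2 : ℝ) ≤ r := by exact_mod_cast hr
  have h3 : τ ^ 3 < τ := by nlinarith [mul_pos h0 h0]
  unfold decayCoeff
  nlinarith [mul_nonneg (sub_nonneg.2 this) (by positivity : 0 ≤ τ + τ ^ 2), sq_nonneg τ]

theorem armSol_pos {r : ℕ} (hr : 2 ≤ r) {p : ℝ} (h0 : 0 < p) (h1 : p < 1)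
    (ha : 0 < centreCoeff r (p ^ 2)) (k : ℕ) : 0 < armSol r p k := by
  have := decayCoeff_pos hr (pow_pos h0 2) (pow_lt_one₀ h0.le h1 two_ne_zero)
  unfold armSol
  positivity

theorem stemSol_pos {p : ℝ} (h0 : 0 < p) (h1 : p < 1) {k : ℕ} (hk : k ≠ 0) : 0 < stemSol p k := by
  have : (p ^ 2) ^ k < 1 := pow_lt_one₀ (by positivity) (pow_lt_one₀ h0.le h1 two_ne_zero) hk
  unfold stemSol
  exact div_pos (by linarith) (by positivity)

/-- The ratio is the value at the root's neighbour once the root is normalised to 1. In this affine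
form the root equation becomes a sum of terms monotone in the path lengths. -/
theorem armSol_ratio {r : ℕ} (hr : 2 ≤ r) {p : ℝ} (h0 : 0 < p) (h1 : p < 1)
    (ha : 0 < centreCoeff r (p ^ 2)) (k : ℕ) :
    p * (armSol r p k / armSol r p (k + 1)) = 1 - (1 - p ^ 2) * armTerm r (k + 1) (p ^ 2) := by
  have hb := decayCoeff_pos hr (pow_pos h0 2) (pow_lt_one₀ h0.le h1 two_ne_zero)
  simp only [armSol, armTerm]
  generalize centreCoeff r (p ^ 2) = a at *
  generalize decayCoeff r (p ^ 2) = b at *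
  have : a + b * (p ^ 2) ^ (k + 1) ≠ 0 := by positivity
  have h2 : p ^ k ≠ 0 := by positivity
  rw [pow_succ p k]
  field_simp
  ring

theorem stemSol_ratio {p : ℝ} (h0 : 0 < p) (h1 : p < 1) (k : ℕ) :
    p * (stemSol p k / stemSol p (k + 1)) = 1 - (1 - p ^ 2) * (1 / (1 - (p ^ 2) ^ (k + 1))) := by
  have : (p ^ 2) ^ (k + 1) < 1 :=
    pow_lt_one₀ (by positivity) (pow_lt_one₀ h0.le h1 two_ne_zero) k.succ_ne_zero
  simp only [stemSol]
  have : 1 - (p ^ 2) ^ (k + 1) ≠ 0 := by linarith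
  have h2 : p ^ k ≠ 0 := by positivity
  rw [pow_succ p k]
  field_simp
  ring

theorem rho_eq {r₁ r₂ : ℕ} {T : Label} (hr₁ : 2 ≤ r₁) (hr₂ : 2 ≤ r₂)
    (hh : 1 ≤ T.h) (hq₁ : 1 ≤ T.q₁) (hq₂ : 1 ≤ T.q₂) {p : ℝ} (h0 : 0 < p) (h1 : p < 1)
    (ha₁ : 0 < centreCoeff r₁ (p ^ 2)) (ha₂ : 0 < centreCoeff r₂ (p ^ 2))
    (hroot : rootFun r₁ r₂ T (p ^ 2) = 0) : rho r₁ r₂ T = p + p⁻¹ := by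
  classical
  have hp := h0.ne'
  have hτ : p ^ 4 < 1 := pow_lt_one₀ h0.le h1 (by norm_num)
  have hτ2 : p ^ 2 < 1 := pow_lt_one₀ h0.le h1 (by norm_num)
  have hY := armSol_pos hr₁ h0 h1 ha₁
  have hZ := armSol_pos hr₂ h0 h1 ha₂
  have hS := stemSol_pos h0 h1 (k := T.h + 1) (by omega)
  have : Nonempty (Vertex r₁ r₂ T) := ⟨.root⟩
  have hray : ∀ r, armSol r p 0 + p ^ 2 * (1 - p ^ 2) = (p + p⁻¹) * (p * (1 - p ^ 4)) := by
    intro r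
    simp only [armSol, centreCoeff, decayCoeff]
    field_simp
    ring
  have hleaf : p * (1 - p ^ 4) = (p + p⁻¹) * (p ^ 2 * (1 - p ^ 2)) := by
    field_simp
    ring
  -- Each branch is scaled to take the value 1 at the root; the solutions count distance from the
  -- far end, hence the reversed indices.
  refine index_eq_of_pos _ (x := treeVector
    (fun i => stemSol p (T.h + 1 - i) / stemSol p (T.h + 1))
    (fun i => armSol r₁ p (T.q₁ - i) / armSol r₁ p T.q₁)
    (fun i => armSol r₂ p (T.q₂ - i) / armSol r₂ p T.q₂)
    (p * (1 - p ^ 4) / armSol r₁ p T.q₁) (p ^ 2 * (1 - p ^ 2) / armSol r₁ p T.q₁)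
    (p * (1 - p ^ 4) / armSol r₂ p T.q₂) (p ^ 2 * (1 - p ^ 2) / armSol r₂ p T.q₂)) ?_ ?_
  · have e1 : 0 < 1 - p ^ 4 := by linarith
    have e2 : 0 < 1 - p ^ 2 := by linarith
    have := hY T.q₁
    have := hZ T.q₂
    rintro (_ | i | i | i | ⟨k, s⟩ | ⟨k, s⟩) <;> simp only [treeVector]
    · exact div_pos (by simpa using hS) hS
    · exact div_pos (stemSol_pos h0 h1 (by omega)) hS
    · exact div_pos (hY _) (hY _)
    · exact div_pos (hZ _) (hZ _)
    · split_ifs <;> positivity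
    · split_ifs <;> positivity
  · refine treeVector_eigen hh hq₁ hq₂ ?_ ?_ ?_ ?_ ?_ ?_ ?_ ?_ ?_ ?_ ?_ ?_
    · simp [hS.ne', (hY _).ne']
    · simp [hS.ne', (hZ _).ne']
    · have e0 := stemSol_ratio h0 h1 T.h
      have e1 := armSol_ratio hr₁ h0 h1 ha₁ (T.q₁ - 1)
      have e2 := armSol_ratio hr₂ h0 h1 ha₂ (T.q₂ - 1)
      rw [Nat.sub_add_cancel hq₁] at e1
      rw [Nat.sub_add_cancel hq₂] at e2
      simp only [Nat.add_sub_cancel, Nat.sub_zero, div_self hS.ne', mul_one]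
      refine mul_left_cancel₀ hp ?_
      rw [mul_add, mul_add, e0, e1, e2, mul_add, mul_inv_cancel₀ hp]
      have e3 : 1 / (1 - (p ^ 2) ^ (T.h + 1)) + armTerm r₁ T.q₁ (p ^ 2) +
          armTerm r₂ T.q₂ (p ^ 2) = 1 + 1 / (1 - p ^ 2) := by
        unfold rootFun at hroot
        linarith
      have e4 : (1 - p ^ 2) * (1 / (1 - p ^ 2)) = 1 := by
        rw [mul_one_div, div_self (by linarith)]
      linear_combination (-(1 - p ^ 2)) * e3 - e4
    · intro i hi
      have := stemSol_rec hp (T.h - 1 - i)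
      rw [show T.h - 1 - i + 2 = T.h + 1 - i by omega,
        show T.h - 1 - i + 1 = T.h + 1 - (i + 1) by omega] at this
      rw [← mul_div_assoc (p + p⁻¹), ← this]
      split_ifs with hi'
      · rw [show T.h + 1 - (i + 2) = T.h - 1 - i by omega]
        ring
      -- At the leaf the missing neighbour contributes `stemSol p 0 = 0`.
      · rw [show T.h - 1 - i = 0 by omega]
        simp [stemSol]
    · intro i hi
      have := armSol_rec r₁ hp (T.q₁ - (i + 2))
      rw [show T.q₁ - (i + 2) + 2 = T.q₁ - i by omega,
        show T.q₁ - (i + 2) + 1 = T.q₁ - (i + 1) by omega] at this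
      rw [← mul_div_assoc (p + p⁻¹), ← this]
      ring
    · have := armSol_centre r₁ hp
      simp only [Nat.sub_self]
      rw [Nat.sub_sub_self hq₁, ← mul_div_assoc (p + p⁻¹), ← this]
      ring
    · intro i hi
      have := armSol_rec r₂ hp (T.q₂ - (i + 2))
      rw [show T.q₂ - (i + 2) + 2 = T.q₂ - i by omega,
        show T.q₂ - (i + 2) + 1 = T.q₂ - (i + 1) by omega] at this
      rw [← mul_div_assoc (p + p⁻¹), ← this]
      ring
    · have := armSol_centre r₂ hp
      simp only [Nat.sub_self]
      rw [Nat.sub_sub_self hq₂, ← mul_div_assoc (p + p⁻¹), ← this]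
      ring
    · rw [Nat.sub_self, ← mul_div_assoc (p + p⁻¹), ← hray r₁]
      ring
    · rw [← mul_div_assoc (p + p⁻¹), ← hleaf]
    · rw [Nat.sub_self, ← mul_div_assoc (p + p⁻¹), ← hray r₂]
      ring
    · rw [← mul_div_assoc (p + p⁻¹), ← hleaf]

/-! ### Zeros of the root function -/

theorem exists_centreCoeff_eq_zero {r : ℕ} (hr : 2 ≤ r) :
    ∃ σ : ℝ, 0 < σ ∧ σ < 1 ∧ centreCoeff r σ = 0 := by
  have hr' : (2 : ℝ) ≤ r := by exact_mod_cast hr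
  have hc : ContinuousOn (centreCoeff r) (Set.Icc 0 1) := by
    unfold centreCoeff
    fun_prop
  obtain ⟨σ, hσ, h0⟩ := intermediate_value_Ioo' zero_le_one hc
    (show (0 : ℝ) ∈ Set.Ioo _ _ from ⟨by norm_num [centreCoeff]; linarith, by norm_num [centreCoeff]⟩)
  exact ⟨σ, hσ.1, hσ.2, h0⟩

theorem centreCoeff_anti {r s : ℕ} (hr : 1 ≤ r) (hrs : r ≤ s) {τ σ : ℝ} (h0 : 0 ≤ τ)
    (hτσ : τ ≤ σ) : centreCoeff s σ ≤ centreCoeff r τ := by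
  have h1 : (1 : ℝ) ≤ r := by exact_mod_cast hr
  have h2 : (r : ℝ) ≤ s := by exact_mod_cast hrs
  unfold centreCoeff
  gcongr
  linarith

theorem centreCoeff_pos_of_lt {r s : ℕ} (hr : 2 ≤ r) (hrs : r ≤ s) {τ σ : ℝ} (h0 : 0 ≤ τ)
    (hτσ : τ < σ) (hσ : centreCoeff s σ = 0) : 0 < centreCoeff r τ := by
  refine lt_of_lt_of_le ?_ (centreCoeff_anti (by omega) hrs h0 le_rfl)
  have h1 : (2 : ℝ) ≤ s := by exact_mod_cast hr.trans hrs
  rw [← hσ]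
  unfold centreCoeff
  have : τ + τ ^ 2 < σ + σ ^ 2 := by gcongr
  have := mul_lt_mul_of_pos_left this (show (0 : ℝ) < s - 1 by linarith)
  linarith

theorem armTerm_denom_pos {r q : ℕ} (hr : 2 ≤ r) {τ : ℝ} (h0 : 0 ≤ τ) (h1 : τ < 1)
    (ha : 0 ≤ centreCoeff r τ) : 0 < centreCoeff r τ + decayCoeff r τ * τ ^ q := by
  rcases h0.eq_or_lt with rfl | h0
  · norm_num [centreCoeff, decayCoeff]
  · have := decayCoeff_pos hr h0 h1
    positivity

theorem continuousOn_rootFun {r₁ r₂ : ℕ} (T : Label) (hr₁ : 2 ≤ r₁) (hr : r₁ ≤ r₂) {σ : ℝ}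
    (hσ1 : σ < 1) (hσ : centreCoeff r₂ σ = 0) :
    ContinuousOn (rootFun r₁ r₂ T) (Set.Icc 0 σ) := by
  have harm : ∀ r q : ℕ, 2 ≤ r → r ≤ r₂ → ContinuousOn (armTerm r q) (Set.Icc 0 σ) := by
    intro r q hr2 hrr
    refine ContinuousOn.div ?_ ?_ fun τ hτ => (armTerm_denom_pos hr2 hτ.1 (hτ.2.trans_lt hσ1)
      (hσ.symm.le.trans (centreCoeff_anti (by omega) hrr hτ.1 hτ.2))).ne'
    · unfold centreCoeff
      fun_prop
    · unfold centreCoeff decayCoeff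
      fun_prop
  have hpow : ∀ k : ℕ, k ≠ 0 → ContinuousOn (fun τ : ℝ => 1 / (1 - τ ^ k)) (Set.Icc 0 σ) := by
    intro k hk
    refine ContinuousOn.div (by fun_prop) (by fun_prop) fun τ hτ => ?_
    have := pow_lt_one₀ hτ.1 (hτ.2.trans_lt hσ1) hk
    linarith
  have h1 := hpow 1 one_ne_zero
  simp only [pow_one] at h1
  exact ((((hpow _ T.h.succ_ne_zero).add (harm r₁ T.q₁ hr₁ hr)).add
    (harm r₂ T.q₂ (hr₁.trans hr) le_rfl)).sub continuousOn_const).sub h1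

theorem one_div_one_sub_pow_lt {τ : ℝ} (h0 : 0 < τ) (h1 : τ < 1) {i j : ℕ} (hi : i ≠ 0)
    (hij : i < j) : 1 / (1 - τ ^ j) < 1 / (1 - τ ^ i) := by
  have h2 := pow_lt_pow_right_of_lt_one₀ h0 h1 hij
  have h3 := pow_lt_one₀ h0.le h1 hi
  exact one_div_lt_one_div_of_lt (by linarith) (by linarith)

theorem armTerm_le_one {r q : ℕ} (hr : 2 ≤ r) {τ : ℝ} (h0 : 0 < τ) (h1 : τ < 1)
    (ha : 0 ≤ centreCoeff r τ) : armTerm r q τ ≤ 1 := by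
  have := decayCoeff_pos hr h0 h1
  refine div_le_one_of_le₀ ?_ (armTerm_denom_pos hr h0.le h1 ha).le
  have : 0 ≤ decayCoeff r τ * τ ^ q := by positivity
  linarith

theorem armTerm_mono {r q q' : ℕ} (hr : 2 ≤ r) (hq : q ≤ q') {τ : ℝ} (h0 : 0 < τ) (h1 : τ < 1)
    (ha : 0 ≤ centreCoeff r τ) : armTerm r q τ ≤ armTerm r q' τ := by
  have := decayCoeff_pos hr h0 h1
  have h2 := armTerm_denom_pos (q := q') hr h0.le h1 ha
  have h3 := pow_le_pow_of_le_one h0.le h1.le hq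
  unfold armTerm
  gcongr

/-- At `σ` the second arm term vanishes, the first is at most 1, and the stem term is below `1 / (1
- σ)`, so `rootFun` is negative there. -/
theorem exists_rootFun_eq_zero {r₁ r₂ : ℕ} {T : Label} (hr₁ : 2 ≤ r₁) (hr : r₁ ≤ r₂)
    (hh : 1 ≤ T.h) {σ τ₀ : ℝ} (hτ₀ : 0 ≤ τ₀) (hτσ : τ₀ < σ) (hσ1 : σ < 1)
    (hσ : centreCoeff r₂ σ = 0) (hpos : 0 < rootFun r₁ r₂ T τ₀) :
    ∃ τ, τ₀ < τ ∧ τ < σ ∧ rootFun r₁ r₂ T τ = 0 := by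
  have hneg : rootFun r₁ r₂ T σ < 0 := by
    have h0 : 0 < σ := hτ₀.trans_lt hτσ
    have h1 := one_div_one_sub_pow_lt h0 hσ1 one_ne_zero (show 1 < T.h + 1 by omega)
    have h2 := armTerm_le_one (q := T.q₁) hr₁ h0 hσ1
      (hσ.symm.le.trans (centreCoeff_anti (by omega) hr h0.le le_rfl))
    have h3 : armTerm r₂ T.q₂ σ = 0 := by simp [armTerm, hσ]
    rw [pow_one] at h1
    unfold rootFun
    linarith
  obtain ⟨τ, hτ, h0⟩ := intermediate_value_Ioo' hτσ.le
    ((continuousOn_rootFun T hr₁ hr hσ1 hσ).mono (Set.Icc_subset_Icc_left hτ₀)) ⟨hneg, hpos⟩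
  exact ⟨τ, hτ.1, hτ.2, h0⟩

theorem rho_eq_sqrt {r₁ r₂ : ℕ} {T : Label} (hr₁ : 2 ≤ r₁) (hr : r₁ ≤ r₂)
    (hh : 1 ≤ T.h) (hq₁ : 1 ≤ T.q₁) (hq₂ : 1 ≤ T.q₂) {σ τ : ℝ} (hτ : 0 < τ) (hτσ : τ < σ)
    (hσ1 : σ < 1) (hσ : centreCoeff r₂ σ = 0) (h0 : rootFun r₁ r₂ T τ = 0) :
    rho r₁ r₂ T = √τ + (√τ)⁻¹ := by
  have hsq : √τ ^ 2 = τ := Real.sq_sqrt hτ.le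
  refine rho_eq hr₁ (hr₁.trans hr) hh hq₁ hq₂ (Real.sqrt_pos.2 hτ) ?_ ?_ ?_ ?_
  · rw [Real.sqrt_lt' one_pos]
    linarith
  · rw [hsq]
    exact centreCoeff_pos_of_lt hr₁ hr hτ.le hτσ hσ
  · rw [hsq]
    exact centreCoeff_pos_of_lt (hr₁.trans hr) le_rfl hτ.le hτσ hσ
  · rwa [hsq]

/-- Uniqueness of the zero is not needed: every zero in `(0, σ)` computes the index. -/
theorem rho_lt_of_rootFun {r₁ r₂ : ℕ} {T T' : Label} (hr₁ : 2 ≤ r₁) (hr : r₁ ≤ r₂)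
    (hh : 1 ≤ T.h) (hq₁ : 1 ≤ T.q₁) (hq₂ : 1 ≤ T.q₂)
    (hh' : 1 ≤ T'.h) (hq₁' : 1 ≤ T'.q₁) (hq₂' : 1 ≤ T'.q₂)
    (H : ∀ τ, 0 < τ → τ < 1 → 0 < centreCoeff r₂ τ → rootFun r₁ r₂ T τ = 0 →
      0 < rootFun r₁ r₂ T' τ) :
    rho r₁ r₂ T' < rho r₁ r₂ T := by
  obtain ⟨σ, hσ0, hσ1, hσ⟩ := exists_centreCoeff_eq_zero (hr₁.trans hr)
  have hzero : 0 < rootFun r₁ r₂ T 0 := by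
    simp [rootFun, armTerm, centreCoeff, decayCoeff]
  obtain ⟨τ, hτ, hτσ, hroot⟩ := exists_rootFun_eq_zero hr₁ hr hh le_rfl hσ0 hσ1 hσ hzero
  have hpos := H τ hτ (hτσ.trans hσ1)
    (centreCoeff_pos_of_lt (hr₁.trans hr) le_rfl hτ.le hτσ hσ) hroot
  obtain ⟨τ', hττ', hτσ', hroot'⟩ := exists_rootFun_eq_zero hr₁ hr hh' hτ.le hτσ hσ1 hσ hpos
  rw [rho_eq_sqrt hr₁ hr hh hq₁ hq₂ hτ hτσ hσ1 hσ hroot,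
    rho_eq_sqrt hr₁ hr hh' hq₁' hq₂' (hτ.trans hττ') hτσ' hσ1 hσ hroot']
  have h1 : 0 < √τ := Real.sqrt_pos.2 hτ
  have h2 : √τ < √τ' := Real.sqrt_lt_sqrt hτ.le hττ'
  have h3 : √τ' < 1 := by
    rw [Real.sqrt_lt' one_pos]
    linarith
  generalize √τ = p at *
  generalize √τ' = p' at *
  have h4 : 0 < p' := h1.trans h2
  have h5 : p + p⁻¹ - (p' + p'⁻¹) = (p' - p) * (1 - p * p') / (p * p') := by
    field_simp
    ring
  have h6 : 0 < (p' - p) * (1 - p * p') / (p * p') := by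
    have : 0 < 1 - p * p' := by nlinarith
    have : 0 < p' - p := by linarith
    positivity
  linarith

/-! ### Comparison of indices -/

theorem rho_lt_of_le {r₁ r₂ : ℕ} {T T' : Label} (hr₁ : 2 ≤ r₁) (hr : r₁ ≤ r₂)
    (hq₁ : 1 ≤ T.q₁) (hq₂ : 1 ≤ T.q₂) (hh' : 1 ≤ T'.h)
    (hh : T'.h < T.h) (h₁ : T.q₁ ≤ T'.q₁) (h₂ : T.q₂ ≤ T'.q₂) :
    rho r₁ r₂ T' < rho r₁ r₂ T := by
  refine rho_lt_of_rootFun hr₁ hr (by omega) hq₁ hq₂ hh' (by omega) (by omega) ?_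
  intro τ h0 h1 ha h
  have e0 := one_div_one_sub_pow_lt h0 h1 (show T'.h + 1 ≠ 0 by omega) (show T'.h + 1 < T.h + 1 by omega)
  have e1 := armTerm_mono hr₁ h₁ h0 h1 (ha.le.trans (centreCoeff_anti (by omega) hr h0.le le_rfl))
  have e2 := armTerm_mono (hr₁.trans hr) h₂ h0 h1 ha.le
  unfold rootFun at *
  linarith

theorem rho_lt_of_wrap {r₁ r₂ : ℕ} (hr₁ : 2 ≤ r₁) (hr : r₁ < r₂) {k z : ℕ} (hk : 1 ≤ k)
    (hz : 1 ≤ z) : rho r₁ r₂ ⟨k, 2, z + 1⟩ < rho r₁ r₂ ⟨2, k + 1, z⟩ := by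
  refine rho_lt_of_rootFun hr₁ hr.le (by simp) (by simp) hz hk (by simp) (by simp) ?_
  intro τ h0 h1 ha₂ h
  have hr' : (r₁ : ℝ) + 1 ≤ r₂ := by exact_mod_cast hr
  have hr₁' : (2 : ℝ) ≤ r₁ := by exact_mod_cast hr₁
  have ht : 0 < τ + τ ^ 2 := by positivity
  have hb₂ := decayCoeff_pos (show 2 ≤ r₂ by omega) h0 h1
  have hb₁ := decayCoeff_pos hr₁ h0 h1
  -- One ray fewer raises the centre coefficient by `τ + τ ^ 2`, and the coefficient for `r₂` is
  -- positive.
  have ha₁ : τ + τ ^ 2 ≤ centreCoeff r₁ τ := by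
    unfold centreCoeff at *
    nlinarith
  have ha₁' := ht.trans_le ha₁
  have hbN : decayCoeff r₁ τ ≤ 1 - τ - τ ^ 2 - τ ^ 3 := by
    unfold centreCoeff at ha₁
    unfold decayCoeff
    linarith
  -- Here `r₂ ≥ 3`.
  have hsmall : 0 < 1 - 2 * τ - 2 * τ ^ 2 := by
    unfold centreCoeff at ha₂
    nlinarith
  have hτ3 : τ ^ 3 < 1 := pow_lt_one₀ h0.le h1 (by norm_num)
  have hB : 0 < 1 + 2 * τ - τ ^ 2 - τ ^ 3 - τ ^ 4 := by
    have : τ ^ 4 ≤ τ ^ 2 := pow_le_pow_of_le_one h0.le h1.le (by norm_num)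
    nlinarith
  have hA : 0 < 2 - τ ^ 2 - τ ^ 3 := by nlinarith
  have e1 : (1 + τ) / (1 + 2 * τ - τ ^ 2 - τ ^ 3 - τ ^ 4) ≤ armTerm r₁ 2 τ := by
    unfold armTerm
    rw [div_le_div_iff₀ hB (by positivity)]
    have : decayCoeff r₁ τ * (τ * (1 + τ)) ≤
        (1 - τ - τ ^ 2 - τ ^ 3) * centreCoeff r₁ τ := by
      refine mul_le_mul hbN (by linarith) (by positivity) (hb₁.le.trans hbN)
    nlinarith
  -- The root equation of `[2, k+1, z]`, with its first arm term at most 1, bounds `armTerm r₂ z τ`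
  -- below; one more vertex multiplies `b τ ^ z` by `τ`.
  have e2 : (1 + τ) / (2 - τ ^ 2 - τ ^ 3) ≤ armTerm r₂ (z + 1) τ := by
    have e3 : τ * (1 + τ) / (1 - τ ^ 3) ≤ armTerm r₂ z τ := by
      have e4 := armTerm_le_one (q := k + 1) hr₁ h0 h1 ha₁'.le
      have e5 : τ * (1 + τ) / (1 - τ ^ 3) = 1 / (1 - τ) - 1 / (1 - τ ^ 3) := by
        have : 1 - τ ^ 3 ≠ 0 := by linarith
        have : 1 - τ ≠ 0 := by linarith
        field_simp
        ring
      unfold rootFun at h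
      simp only [Nat.reduceAdd] at h
      linarith
    unfold armTerm at *
    rw [div_le_div_iff₀ (by linarith) (by positivity)] at e3
    rw [div_le_div_iff₀ hA (by positivity)]
    rw [pow_succ]
    linarith
  have e3 : 1 ≤ 1 / (1 - τ ^ (k + 1)) := by
    have := pow_lt_one₀ h0.le h1 (show k + 1 ≠ 0 by omega)
    have : 0 < τ ^ (k + 1) := by positivity
    rw [le_div_iff₀ (by linarith)]
    linarith
  have e4 : 1 / (1 - τ) <
      (1 + τ) / (2 - τ ^ 2 - τ ^ 3) + (1 + τ) / (1 + 2 * τ - τ ^ 2 - τ ^ 3 - τ ^ 4) := by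
    -- Cleared of denominators, right minus left is `1 - 2τ - 2τ² + τ³ + 4τ⁴ - τ⁶ - τ⁷`.
    rw [div_add_div _ _ hA.ne' hB.ne', div_lt_div_iff₀ (by linarith) (by positivity)]
    have h6 : τ ^ 6 ≤ τ ^ 4 := pow_le_pow_of_le_one h0.le h1.le (by norm_num)
    have h7 : τ ^ 7 ≤ τ ^ 4 := pow_le_pow_of_le_one h0.le h1.le (by norm_num)
    have h3 : 0 < τ ^ 3 := by positivity
    have h4 : 0 < τ ^ 4 := by positivity
    linarith
  unfold rootFun
  dsimp only
  linarith

theorem rho_lt_of_succeeds {n r₁ r₂ : ℕ} (hr₁ : 2 ≤ r₁) (hr : r₁ < r₂) {T T' : Label}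
    (hT : T ∈ family n r₁ r₂) (hT' : T' ∈ family n r₁ r₂) (h : Succeeds T T') :
    rho r₁ r₂ T' < rho r₁ r₂ T := by
  obtain ⟨x, y, z⟩ := T
  obtain ⟨x', y', z'⟩ := T'
  simp only [family, Set.mem_ofPred_eq, Succeeds] at hT hT' h
  rcases h with h | ⟨rfl, h⟩
  -- `[2, k+1, z]` ends the run of `T`, and `[k, 2, z+1]` starts the next one.
  · obtain ⟨k, hk⟩ : ∃ k, x + y = k + 3 := ⟨x + y - 3, by omega⟩
    have h1 : rho r₁ r₂ ⟨2, k + 1, z⟩ ≤ rho r₁ r₂ ⟨x, y, z⟩ := by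
      rcases (show 2 ≤ x by omega).eq_or_lt with rfl | hx
      · rw [show y = k + 1 by omega]
      · exact (rho_lt_of_le (T := ⟨x, y, z⟩) (T' := ⟨2, k + 1, z⟩) hr₁ hr.le
          (show 1 ≤ y by omega) (show 1 ≤ z by omega) (show 1 ≤ 2 by omega) hx (show y ≤ k + 1 by omega) le_rfl).le
    have h2 : rho r₁ r₂ ⟨x', y', z'⟩ ≤ rho r₁ r₂ ⟨k, 2, z + 1⟩ := by
      rcases (show x' ≤ k by omega).eq_or_lt with rfl | hx
      · rw [show y' = 2 by omega, show z' = z + 1 by omega]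
      · exact (rho_lt_of_le hr₁ hr.le (by simp) (by simp) (by dsimp only; omega) hx
          (by dsimp only; omega) (by dsimp only; omega)).le
    exact h2.trans_lt ((rho_lt_of_wrap hr₁ hr (by omega) (by omega)).trans_le h1)
  · exact rho_lt_of_le hr₁ hr.le (by dsimp only; omega) (by dsimp only; omega)
      (by dsimp only; omega) (by dsimp only; omega) h.le le_rfl

/-! ### The sequence and its order -/

theorem iterate_alpha (k : ℕ) (T : Label) : alpha^[k] T = ⟨T.h - k, T.q₁ + k, T.q₂⟩ := by
  induction k with
  | zero => rfl
  | succ k ih =>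
    rw [Function.iterate_succ_apply', ih]
    ext <;> simp only [alpha] <;> omega

theorem iterate_gamma (k : ℕ) (T : Label) : gamma^[k] T = ⟨T.h - k, T.q₁, T.q₂ + k⟩ := by
  induction k with
  | zero => rfl
  | succ k ih =>
    rw [Function.iterate_succ_apply', ih]
    ext <;> simp only [gamma] <;> omega

theorem mem_chain_iff {h₀ : ℕ} {T : Label} :
    T ∈ chain h₀ ↔ 2 ≤ T.h ∧ 2 ≤ T.q₁ ∧ 2 ≤ T.q₂ ∧ T.h + T.q₁ + T.q₂ = h₀ + 4 := by
  simp only [chain, List.mem_flatMap, List.mem_map, List.mem_range, iterate_alpha, iterate_gamma,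
    topLabel]
  constructor
  · rintro ⟨j, hj, k, hk, rfl⟩
    dsimp only
    omega
  · rintro ⟨h1, h2, h3, h4⟩
    exact ⟨T.q₂ - 2, by omega, T.q₁ - 2, by omega, by ext <;> dsimp only <;> omega⟩

theorem chain_pairwise (h₀ : ℕ) : (chain h₀).Pairwise Succeeds := by
  rw [chain, List.pairwise_flatMap]
  constructor
  · intro j _
    rw [List.pairwise_map]
    refine List.pairwise_lt_range.imp fun {k l} hkl => Or.inr ?_
    simp only [iterate_alpha, iterate_gamma, topLabel, true_and]
    omega
  · refine List.pairwise_lt_range.imp fun {i j} hij => ?_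
    intro x hx y hy
    simp only [List.mem_map, iterate_alpha, iterate_gamma, topLabel] at hx hy
    obtain ⟨k, _, rfl⟩ := hx
    obtain ⟨l, _, rfl⟩ := hy
    refine Or.inl ?_
    dsimp only
    omega

theorem succeeds_trichotomy {n r₁ r₂ : ℕ} {T T' : Label} (hT : T ∈ family n r₁ r₂)
    (hT' : T' ∈ family n r₁ r₂) : T = T' ∨ Succeeds T T' ∨ Succeeds T' T := by
  simp only [family, Set.mem_ofPred_eq] at hT hT'
  simp only [Succeeds, Label.ext_iff]
  omega

end SwitchTree

open SwitchTree in
theorem theorem5p2 (n r₁ r₂ h₀ : ℕ) (hr₁ : 2 ≤ r₁) (hr : r₁ < r₂) (hh₀ : 2 ≤ h₀)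
    (hn : n = h₀ + 5 + 2 * (r₁ + r₂)) :
    -- `T^*` and `T_*` belong to the family
    (SwitchTree.topLabel h₀ ∈ SwitchTree.family n r₁ r₂ ∧
      SwitchTree.botLabel h₀ ∈ SwitchTree.family n r₁ r₂) ∧
    -- (a) the sequence is the family, and its last term is `T_*`
    ((∀ T : SwitchTree.Label, T ∈ SwitchTree.chain h₀ ↔ T ∈ SwitchTree.family n r₁ r₂) ∧
      SwitchTree.gamma^[h₀ - 2] (SwitchTree.topLabel h₀) = SwitchTree.botLabel h₀) ∧
    -- (b) the sequence is arranged in the inverse lexicographic order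
    (SwitchTree.chain h₀).Pairwise SwitchTree.Succeeds ∧
    -- (c) the index strictly decreases along that order
    (∀ T ∈ SwitchTree.family n r₁ r₂, ∀ T' ∈ SwitchTree.family n r₁ r₂,
      SwitchTree.Succeeds T T' → SwitchTree.rho r₁ r₂ T' < SwitchTree.rho r₁ r₂ T) ∧
    -- so distinct trees of the family have distinct indices: the order by index is total
    Set.InjOn (SwitchTree.rho r₁ r₂) (SwitchTree.family n r₁ r₂) ∧
    -- (d) the extremal indices
    IsGreatest (SwitchTree.rho r₁ r₂ '' SwitchTree.family n r₁ r₂)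
      (SwitchTree.rho r₁ r₂ (SwitchTree.topLabel h₀)) ∧
    IsLeast (SwitchTree.rho r₁ r₂ '' SwitchTree.family n r₁ r₂)
      (SwitchTree.rho r₁ r₂ (SwitchTree.botLabel h₀)) := by
  subst hn
  have htop : topLabel h₀ ∈ family (h₀ + 5 + 2 * (r₁ + r₂)) r₁ r₂ := by
    simp only [family, topLabel, Set.mem_ofPred_eq]
    omega
  have hbot : botLabel h₀ ∈ family (h₀ + 5 + 2 * (r₁ + r₂)) r₁ r₂ := by
    simp only [family, botLabel, Set.mem_ofPred_eq]
    omega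
  have hlt := fun T hT T' hT' => rho_lt_of_succeeds
    (n := h₀ + 5 + 2 * (r₁ + r₂)) hr₁ hr (T := T) (T' := T') hT hT'
  refine ⟨⟨htop, hbot⟩, ⟨fun T => ?_, ?_⟩, chain_pairwise h₀, hlt, ?_, ⟨⟨_, htop, rfl⟩, ?_⟩,
    ⟨⟨_, hbot, rfl⟩, ?_⟩⟩
  · rw [mem_chain_iff]
    simp only [family, Set.mem_ofPred_eq]
    omega
  · rw [iterate_gamma]
    simp only [topLabel, botLabel, Label.mk.injEq, true_and]
    omega
  · intro T hT T' hT' h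
    rcases succeeds_trichotomy hT hT' with h1 | h1 | h1
    · exact h1
    · exact absurd h (hlt T hT T' hT' h1).ne'
    · exact absurd h (hlt T' hT' T hT h1).ne
  · rintro _ ⟨T, hT, rfl⟩
    rcases succeeds_trichotomy htop hT with rfl | h1 | h1
    · exact le_rfl
    · exact (hlt _ htop _ hT h1).le
    · simp only [family, Set.mem_ofPred_eq] at hT
      simp only [Succeeds, topLabel] at h1
      omega
  · rintro _ ⟨T, hT, rfl⟩
    rcases succeeds_trichotomy hbot hT with rfl | h1 | h1
    · exact le_rfl
    · simp only [family, Set.mem_ofPred_eq] at hT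
      simp only [Succeeds, botLabel] at h1
      omega
    · exact (hlt _ hT _ hbot h1).le
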